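/- \textbf{Setting.} Let $V$ be a finite set and let $c\colon V\times V\to\mathbb R$ be symmetric edge costs of the complete graph on $V$ that satisfy the triangle inequality (with $c(v,v)=0$). Let $V$ be partitioned into clusters $C_1,\dots,C_k$, let $V'\subseteq V$ be a set of required vertices and $E'$ a set of required edges, each with both ends in the same cluster. Let $E'_i$ be the set of required edges in $C_i$ and let $\overline V_i\subseteq C_i$ be the set of vertices of $C_i$ that lie in $V'$ or on an edge of $E'$. A \emph{cluster routing tour} is a closed walk that visits every vertex of $\bigcup_i\overline V_i$ exactly once, traverses every edge of $E'$, and visits the vertices of each cluster consecutively (other vertices may be visited or not). Let $OPT$ also denote the cost of an optimal (minimum-cost) cluster routing tour. Cut this tour into its segments inside the clusters, and let $L$ be the sum of the lengths of these segments, not counting the edges between consecutive segments, nor the closing edge if there is only one segment. Below, $i$ ranges over the clusters with $\overline V_i\neq\emptyset$. Let $s_i,t_i\in\overline V_i$ be such that $c(s_i,t_i)=\max_{x,y\in\overline V_i}c(x,y)$, and let $D=\sum_i c(s_i,t_i)$. \textbf{Algorithm.} (1) For every $i$ compute a path $p_i$ as follows. Let $U_i$ be the set of vertices of $\overline V_i$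 incident with at most one edge of $E'_i$. Contract the components of the graph $(\overline V_i,E'_i)$, let the cost of a pair of components be the cost of the cheapest link between them with both ends in $U_i$, and take a minimum spanning tree $F_i$. Let $O_i$ be the set of odd-degree vertices of $E'_i\cup F_i$ and add a cheapest matching of $O_i$ that leaves exactly two vertices of $O_i$ unmatched (the empty matching if $O_i=\emptyset$). Take an Eulerian walk of the resulting multigraph and shortcut it to a path $p_i$ that visits each vertex of $\overline V_i$ exactly once and still traverses all edges of $E'_i$. Let $a_i,b_i$ be the ends of $p_i$. (2) Apply the following two algorithms to the rural postman problem with special edges $(a_i,b_i)$ (where $a_i=b_i$ means that $a_i$ has to be visited), and let $R$ be the shorter one of the two closed walks. \emph{Short-Arcs 2}: shrink the special edges, connect them by a minimum spanning tree (cheapest links between ends of special edges), add a minimum-cost perfect matching of the odd-degree vertices of the union of the special edges and the tree, and take an Eulerian closed walk. \emph{Long-Arcs 2}: complete the special edges to a cycle cover by a minimum-cost perfect matching of their ends, find a set of edges of minimum total cost that connects the cycles, add two copies of each of these, and take an Eulerian closed walk. (3) Let $T_1$ be the closed walk obtained from $R$ by replacing one traversal of each special edge $(a_i,b_i)$ by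 the path $p_i$ in the same direction; visits made by $R$ between these traversals may be skipped. \textbf{Theorem.} Every tour $T_1$ computed in this way (whatever choices are made in case of ties, for the Eulerian walks and for the shortcuts) satisfies, for every optimal tour, $$c(T_1)\le \tfrac32\,OPT+\tfrac12\,L+2D .$$ -/

import Mathlib

namespace ClusterRouting

/-! ## Walks in a complete graph, spanning trees, matchings -/

section Graph

variable {V : Type*}

/-- The edges traversed by the walk that visits the listed vertices in this order. -/
def pathEdges : List V → List (Sym2 V)
  | [] => []
  | [_] => []
  | x :: y :: l => s(x, y) :: pathEdges (y :: l)

/-- The edges traversed by the closed walk that visits the listed vertices in this order and then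
returns to the first one. -/
def cycleEdges : List V → List (Sym2 V)
  | [] => []
  | x :: l => pathEdges (x :: (l ++ [x]))

/-- Any two vertices of `S` are joined by a path all of whose edges belong to `B`. -/
def Linked (S : Finset V) (B : Set (Sym2 V)) : Prop :=
  ∀ x ∈ S, ∀ y ∈ S, (SimpleGraph.fromEdgeSet B).Reachable x y

/-- Contract every connected component of the graph `(S, B)` to a single vertex.  `F` is (the set
of edges of) a spanning tree of the resulting graph, where an edge joining two components may be
realised by any link both of whose ends lie in `U`: an inclusion-minimal set of links that,
together with `B`, connects `S`. -/
structure IsSpanningTree [DecidableEq V] (S U : Finset V) (B : Set (Sym2 V))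
    (F : Finset (Sym2 V)) : Prop where
  links : ∀ e ∈ F, ∀ v ∈ e, v ∈ U
  linked : Linked S (B ∪ (F : Set (Sym2 V)))
  minimal : ∀ e ∈ F, ¬ Linked S (B ∪ (F.erase e : Set (Sym2 V)))

/-- `F` is a spanning tree of minimum total cost.  (Equivalently: a minimum spanning tree of the
complete graph on the components, where the cost of a pair of components is the cost of the
cheapest admissible link between them.) -/
def IsMST [DecidableEq V] (w : Sym2 V → ℝ) (S U : Finset V) (B : Set (Sym2 V))
    (F : Finset (Sym2 V)) : Prop :=
  IsSpanningTree S U B F ∧ ∀ F', IsSpanningTree S U B F' → ∑ e ∈ F, w e ≤ ∑ e ∈ F', w e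

/-- The degree of `v` in the multigraph with edge multiset `H`.  Loops are left out: they do not
influence the parity of a degree. -/
def deg [DecidableEq V] (H : Multiset (Sym2 V)) (v : V) : ℕ :=
  (H.filter fun e => v ∈ e ∧ ¬ e.IsDiag).card

/-- The vertices of odd degree of the multigraph with edge multiset `H`. -/
def oddVertices [Fintype V] [DecidableEq V] (H : Multiset (Sym2 V)) : Finset V :=
  Finset.univ.filter fun v => Odd (deg H v)

/-- `M` is a set of pairwise disjoint pairs of distinct elements of `S`. -/
structure IsMatching (S : Finset V) (M : Finset (Sym2 V)) : Prop where
  not_loop : ∀ e ∈ M, ¬ e.IsDiag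
  subset : ∀ e ∈ M, ∀ v ∈ e, v ∈ S
  disjoint : ∀ e ∈ M, ∀ f ∈ M, ∀ v, v ∈ e → v ∈ f → e = f

/-- `M` is a matching of `S` that has exactly `m` pairs and is cheapest among those. -/
def IsMinMatching (w : Sym2 V → ℝ) (S : Finset V) (m : ℕ) (M : Finset (Sym2 V)) : Prop :=
  (IsMatching S M ∧ M.card = m) ∧
    ∀ M', IsMatching S M' → M'.card = m → ∑ e ∈ M, w e ≤ ∑ e ∈ M', w e

/-! ## The rural postman algorithms

The special edges are `(a j, b j)`, `j : J`; `a j = b j` is allowed and means that the vertex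
`a j` has to be visited. -/

/-- One leg of a rural postman walk: traverse the special edge number `idx` (from `a idx` to
`b idx`, or backwards if `flip` is true), then visit the vertices of `mid`, and go on to the next
leg. -/
structure Leg (J V : Type*) where
  idx : J
  flip : Bool
  mid : List V

variable {J : Type*}

/-- The vertices visited by the closed walk consisting of the given legs. -/
def postmanWalk (a b : J → V) (R : List (Leg J V)) : List V :=
  R.flatMap fun r => (if r.flip then [b r.idx, a r.idx] else [a r.idx, b r.idx]) ++ r.mid

/-- The closed walk that results from `postmanWalk` when every special edge number `j` is replaced
by the path `p j` (traversed in the same direction as the special edge). -/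
def expandWalk (p : J → List V) (R : List (Leg J V)) : List V :=
  R.flatMap fun r => (if r.flip then (p r.idx).reverse else p r.idx) ++ r.mid

/-- `R'` arises from `R` by skipping some (possibly none) of the visits between special edges. -/
def IsShortcut (R R' : List (Leg J V)) : Prop :=
  List.Forall₂ (fun r r' => r'.idx = r.idx ∧ r'.flip = r.flip ∧ r'.mid.Sublist r.mid) R R'

variable [Fintype J]

/-- The multiset of special edges. -/
def specialEdges (a b : J → V) : Multiset (Sym2 V) :=
  (Finset.univ : Finset J).val.map fun j => s(a j, b j)

/-- The end vertices of the special edges. -/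
def specialEnds [DecidableEq V] (a b : J → V) : Finset V :=
  Finset.univ.image a ∪ Finset.univ.image b

/-- `R` is an Eulerian closed walk of the multigraph with edge multiset `H` (which contains the
special edges); every special edge is singled out once.  Loops do not matter, since a step from a
vertex to itself is no step at all. -/
def IsEulerTour [DecidableEq V] [DecidableEq J] (a b : J → V) (H : Multiset (Sym2 V))
    (R : List (Leg J V)) : Prop :=
  (∀ j, (R.map Leg.idx).count j = 1) ∧
    (cycleEdges (postmanWalk a b R) : Multiset (Sym2 V)).filter (fun e => ¬ e.IsDiag) =
      H.filter fun e => ¬ e.IsDiag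

variable [Fintype V] [DecidableEq V] [DecidableEq J]

/-- Shrink the special edges, connect them by a minimum spanning tree, add a minimum-cost perfect
matching of the vertices that have odd degree in the union of the special edges and the tree, and
take an Eulerian closed walk. -/
def IsShortArcsOutput (w : Sym2 V → ℝ) (a b : J → V) (R : List (Leg J V)) : Prop :=
  ∃ F M : Finset (Sym2 V),
    IsMST w (specialEnds a b) (specialEnds a b) {e | e ∈ specialEdges a b} F ∧
    IsMinMatching w (oddVertices (specialEdges a b + F.val))
      ((oddVertices (specialEdges a b + F.val)).card / 2) M ∧
    IsEulerTour a b (specialEdges a b + F.val + M.val) R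

/-- Complete the special edges to a cycle cover by a minimum-cost perfect matching of their ends
(a special edge `a j = b j` is a cycle by itself), find a set of edges of minimum total cost that
connects the cycles, add two copies of each of these, and take an Eulerian closed walk. -/
def IsLongArcsOutput (w : Sym2 V → ℝ) (a b : J → V) (R : List (Leg J V)) : Prop :=
  ∃ M F : Finset (Sym2 V),
    IsMinMatching w (oddVertices (specialEdges a b)) ((oddVertices (specialEdges a b)).card / 2) M ∧
    IsMST w (specialEnds a b) (specialEnds a b) {e | e ∈ specialEdges a b + M.val} F ∧
    IsEulerTour a b (specialEdges a b + M.val + F.val + F.val) R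

/-- `R` is the shorter one of the two solutions. -/
def IsPostmanOutput (w : Sym2 V → ℝ) (a b : J → V) (R : List (Leg J V)) : Prop :=
  ∃ R₁ R₂ : List (Leg J V), IsShortArcsOutput w a b R₁ ∧ IsLongArcsOutput w a b R₂ ∧
    (R = R₁ ∨ R = R₂) ∧
    ((cycleEdges (postmanWalk a b R)).map w).sum ≤ ((cycleEdges (postmanWalk a b R₁)).map w).sum ∧
    ((cycleEdges (postmanWalk a b R)).map w).sum ≤ ((cycleEdges (postmanWalk a b R₂)).map w).sum

end Graph

/-! ## The general cluster routing problem -/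

/-- An instance: a complete graph on `V` with metric edge costs (`c v v = 0` is a convention;
non-negativity follows), a partition of `V` into clusters, required vertices and required edges,
all required edges lying inside clusters. -/
structure Problem (V : Type*) (k : ℕ) where
  c : V → V → ℝ
  c_self : ∀ x, c x x = 0
  c_symm : ∀ x y, c x y = c y x
  c_triangle : ∀ x y z, c x z ≤ c x y + c y z
  cluster : V → Fin k
  reqV : Finset V
  reqE : Finset (Sym2 V)
  reqE_not_loop : ∀ e ∈ reqE, ¬ e.IsDiag
  reqE_in_cluster : ∀ x y, s(x, y) ∈ reqE → cluster x = cluster y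

namespace Problem

variable {V : Type*} {k : ℕ} (I : Problem V k)

/-- The cost of an edge. -/
def edgeCost : Sym2 V → ℝ := Sym2.lift ⟨I.c, I.c_symm⟩

/-- The cost of a walk that need not be closed. -/
def pathCost (l : List V) : ℝ := ((pathEdges l).map I.edgeCost).sum

/-- The cost of a closed walk. -/
def tourCost (l : List V) : ℝ := ((cycleEdges l).map I.edgeCost).sum

/-- The vertices to be visited: required vertices and ends of required edges. -/
def IsTerminal (v : V) : Prop := v ∈ I.reqV ∨ ∃ e ∈ I.reqE, v ∈ e

/-- A cluster routing tour: a closed walk, cut into its maximal segments inside clusters.  The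
segments lie in different clusters, so the vertices of every cluster are visited consecutively.
Every vertex to be visited is visited exactly once, every required edge is traversed; the other
vertices may be visited or not. -/
structure IsTour [DecidableEq V] (O : List (List V)) : Prop where
  nonempty : ∀ l ∈ O, l ≠ []
  in_cluster : ∀ l ∈ O, ∀ x ∈ l, ∀ y ∈ l, I.cluster x = I.cluster y
  consecutive : O.Pairwise fun l l' => ∀ x ∈ l, ∀ y ∈ l', I.cluster x ≠ I.cluster y
  visits : ∀ v, I.IsTerminal v → O.flatten.count v = 1
  traverses : ∀ e ∈ I.reqE, e ∈ cycleEdges O.flatten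

/-- A cluster routing tour of minimum cost. -/
def IsOptimalTour [DecidableEq V] (O : List (List V)) : Prop :=
  I.IsTour O ∧ ∀ O', I.IsTour O' → I.tourCost O.flatten ≤ I.tourCost O'.flatten

/-- The total length of the segments of a tour inside the clusters. -/
def insideCost (O : List (List V)) : ℝ := (O.map I.pathCost).sum

variable [Fintype V] [DecidableEq V]

instance : DecidablePred I.IsTerminal := fun v => by unfold IsTerminal; infer_instance

/-- The vertices of cluster `i` to be visited. -/
def clusterV (i : Fin k) : Finset V :=
  Finset.univ.filter fun v => I.cluster v = i ∧ I.IsTerminal v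

/-- The required edges of cluster `i`. -/
def clusterE (i : Fin k) : Finset (Sym2 V) :=
  I.reqE.filter fun e => ∀ v, v ∈ e → I.cluster v = i

/-- The vertices of `clusterV i` incident with at most one required edge. -/
def clusterU (i : Fin k) : Finset V :=
  (I.clusterV i).filter fun v => deg (I.clusterE i).val v ≤ 1

/-- The clusters in which something has to be visited. -/
abbrev Active := {i : Fin k // (I.clusterV i).Nonempty}

/-- The path algorithm with unspecified end vertices, in cluster `i`: connect the components of the
graph of required edges by a minimum spanning tree `F`; add a cheapest matching `M` of the
odd-degree vertices that leaves two of them unmatched (there are no odd-degree vertices if there is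
only one vertex); take an Eulerian walk `w`; shortcut it to a path `p` that visits each vertex of
`clusterV i` exactly once and still traverses all required edges. -/
def IsPathOutput (i : Fin k) (p : List V) : Prop :=
  ∃ (F M : Finset (Sym2 V)) (w : List V),
    IsMST I.edgeCost (I.clusterV i) (I.clusterU i) {e | e ∈ I.clusterE i} F ∧
    IsMinMatching I.edgeCost (oddVertices ((I.clusterE i).val + F.val))
      ((oddVertices ((I.clusterE i).val + F.val)).card / 2 - 1) M ∧
    (∀ v, v ∈ w ↔ v ∈ I.clusterV i) ∧
    (pathEdges w : Multiset (Sym2 V)) = (I.clusterE i).val + F.val + M.val ∧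
    p.Sublist w ∧ p.Nodup ∧ (∀ v ∈ I.clusterV i, v ∈ p) ∧ ∀ e ∈ I.clusterE i, e ∈ pathEdges p

/-- `T` is a tour computed by the first half of the algorithm: compute a path `p i` with ends `a i`
and `b i` in every cluster, solve the rural postman problem with special edges `(a i, b i)`, and
replace every special edge by the path (repeated visits may be skipped). -/
def IsPostmanTour (T : List V) : Prop :=
  ∃ (p : I.Active → List V) (a b : I.Active → V) (R R' : List (Leg I.Active V)),
    (∀ i, I.IsPathOutput i.1 (p i)) ∧
    (∀ i, (p i).head? = some (a i)) ∧ (∀ i, (p i).getLast? = some (b i)) ∧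
    IsPostmanOutput I.edgeCost a b R ∧ IsShortcut R R' ∧ T = expandWalk p R'

/-- `s i` and `t i` are two vertices of cluster `i` (among those to be visited) at maximum
distance. -/
def IsFarthestPair (s t : I.Active → V) : Prop :=
  ∀ i, s i ∈ I.clusterV i.1 ∧ t i ∈ I.clusterV i.1 ∧
    ∀ x ∈ I.clusterV i.1, ∀ y ∈ I.clusterV i.1, I.c x y ≤ I.c (s i) (t i)

end Problem

end ClusterRouting

/-! Shortcut the optimal tour to the terminals. By the triangle inequality this increases neither
OPT nor L, and what remains is a cyclic sequence of paths `q i`, one per active cluster, that still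
traverses all required edges (`Problem.IsTour.exists_segments`). Let Q be the total cost of the
paths `q i`, so Q ≤ L.

With at least two active clusters, every required edge lies on its own `q i`. The remaining edges of
`q i` compete with the tree of the path algorithm, and every other edge of `q i`, shortcut to the
odd vertices, competes with its matching. Hence `p i` costs at most 3/2 of `q i`
(`Problem.IsPathOutput.pathCost_le`).

The bound for the postman walk already holds for Short-Arcs 2. Its tree costs at most the links
between special edges taken in the order of the tour; rerouting these through the ends of the
segments shows that they cost at most OPT - Q + 2D (`Problem.sum_linkEdges_le`). Its matching costs
at most OPT/2. Replacing the special edges by the paths trades their cost for that of the `p i`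
(`Problem.tourCost_expandWalk`). The sum is 3/2 Q + (OPT - Q + 2D) + OPT/2 = 3/2 OPT + Q/2 + 2D.

With a single active cluster the closing edge of the tour may itself be required, so the path is
compared with the whole cycle: it costs at most OPT + L/2, there are no links, and the matching
again costs at most OPT/2. -/

namespace ClusterRouting

/-! ### Edges of walks given as lists of vertices -/

section Lists

variable {V : Type*}

@[simp] theorem pathEdges_nil : pathEdges ([] : List V) = [] := rfl

@[simp] theorem pathEdges_singleton (x : V) : pathEdges [x] = [] := rfl

@[simp] theorem pathEdges_cons_cons (x y : V) (l : List V) :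
    pathEdges (x :: y :: l) = s(x, y) :: pathEdges (y :: l) := rfl

theorem pathEdges_append_cons (l : List V) (x : V) (m : List V) :
    pathEdges (l ++ x :: m) = pathEdges (l ++ [x]) ++ pathEdges (x :: m) := by
  induction l with
  | nil => simp
  | cons y l ih =>
    cases l with
    | nil => simp
    | cons z l => simpa using ih

theorem cycleEdges_eq_append {l : List V} {x y : V} (hx : l.head? = some x)
    (hy : l.getLast? = some y) : cycleEdges l = pathEdges l ++ [s(y, x)] := by
  obtain ⟨m, rfl⟩ := List.getLast?_eq_some_iff.1 hy
  have h : cycleEdges (m ++ [y]) = pathEdges (m ++ [y] ++ [x]) := by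
    cases m with
    | nil => simp at hx; subst hx; rfl
    | cons z m => simp at hx; subst hx; rfl
  rw [h, List.append_assoc, List.singleton_append, pathEdges_append_cons]
  rfl

theorem pathEdges_sublist_cycleEdges (l : List V) : (pathEdges l).Sublist (cycleEdges l) := by
  cases l with
  | nil => simp [cycleEdges]
  | cons x l =>
    obtain ⟨y, hy⟩ : ∃ y, (x :: l).getLast? = some y :=
      ⟨_, List.getLast?_eq_some_getLast (List.cons_ne_nil x l)⟩
    rw [cycleEdges_eq_append (x := x) rfl hy]
    exact List.sublist_append_left _ _

theorem mem_of_mem_pathEdges {l : List V} {e : Sym2 V} (he : e ∈ pathEdges l) {v : V}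
    (hv : v ∈ e) : v ∈ l := by
  induction l with
  | nil => simp at he
  | cons x l ih =>
    cases l with
    | nil => simp at he
    | cons y l =>
      rw [pathEdges_cons_cons, List.mem_cons] at he
      rcases he with rfl | he
      · rcases Sym2.mem_iff.1 hv with rfl | rfl <;> simp
      · exact List.mem_cons_of_mem _ (ih he)

theorem mem_of_mem_cycleEdges {l : List V} {e : Sym2 V} (he : e ∈ cycleEdges l) {v : V}
    (hv : v ∈ e) : v ∈ l := by
  cases l with
  | nil => simp [cycleEdges] at he
  | cons x l =>
    have h : v ∈ x :: (l ++ [x]) := mem_of_mem_pathEdges he hv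
    simp only [List.mem_cons, List.mem_append, List.not_mem_nil, or_false] at h ⊢
    tauto

theorem mem_pathEdges_filter {l : List V} (P : V → Prop) [DecidablePred P] {e : Sym2 V}
    (he : e ∈ pathEdges l) (hP : ∀ v ∈ e, P v) : e ∈ pathEdges (l.filter fun v => P v) := by
  induction l with
  | nil => simp at he
  | cons x l ih =>
    cases l with
    | nil => simp at he
    | cons y l =>
      rw [pathEdges_cons_cons, List.mem_cons] at he
      rcases he with rfl | he
      · have hx := hP x (Sym2.mem_mk_left x y)
        have hy := hP y (Sym2.mem_mk_right x y)
        simp [hx, hy]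
      · have h := ih he
        by_cases hx : P x
        · rw [List.filter_cons_of_pos (by simpa using hx)]
          cases hl : (y :: l).filter fun v => P v with
          | nil => simp [hl] at h
          | cons z m => rw [hl] at h; simp [h]
        · rwa [List.filter_cons_of_neg (by simpa using hx)]

/-- Skipping vertices does not separate two consecutive vertices that are both kept; this is why
required edges survive the restriction to terminals. If the base point is dropped, the closing edge
has a dropped end, so the edge in question already lies on the remaining open walk. -/
theorem mem_cycleEdges_filter {l : List V} (P : V → Prop) [DecidablePred P] {e : Sym2 V}
    (he : e ∈ cycleEdges l) (hP : ∀ v ∈ e, P v) : e ∈ cycleEdges (l.filter fun v => P v) := by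
  cases l with
  | nil => simp [cycleEdges] at he
  | cons x l =>
    have h := mem_pathEdges_filter P (l := x :: (l ++ [x])) he hP
    by_cases hx : P x
    · rw [List.filter_cons_of_pos (by simpa using hx)] at h ⊢
      simpa [cycleEdges, hx] using h
    · rw [List.filter_cons_of_neg (by simpa using hx)] at h ⊢
      refine (pathEdges_sublist_cycleEdges _).subset ?_
      simpa [hx] using h

/-- Each edge at `v` has `v` as its earlier end (counted in `dropLast`) or as its later end (counted
in `tail`). -/
theorem countP_pathEdges_le [DecidableEq V] (v : V) (l : List V) :
    (pathEdges l).countP (fun e => v ∈ e) ≤ l.dropLast.count v + l.tail.count v := by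
  induction l with
  | nil => simp
  | cons x l ih =>
    cases l with
    | nil => simp
    | cons y l =>
      rw [pathEdges_cons_cons, List.countP_cons, List.dropLast_cons_cons, List.tail_cons,
        List.count_cons, List.count_cons]
      rw [List.tail_cons] at ih
      have : (if decide (v ∈ s(x, y)) = true then 1 else 0) ≤
          (if (x == v) = true then 1 else 0) + if (y == v) = true then 1 else 0 := by
        by_cases h : v ∈ s(x, y)
        · rcases Sym2.mem_iff.1 h with rfl | rfl <;> simp
        · simp [h]
      omega

theorem countP_cycleEdges_le_two [DecidableEq V] (v : V) {l : List V} (hl : l.Nodup) :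
    (cycleEdges l).countP (fun e => v ∈ e) ≤ 2 := by
  cases l with
  | nil => simp [cycleEdges]
  | cons x l =>
    have h := countP_pathEdges_le v (x :: (l ++ [x]))
    have h1 : (x :: (l ++ [x])).dropLast = x :: l := by
      rw [← List.cons_append, List.dropLast_concat]
    have h2 : (x :: (l ++ [x])).tail.count v = (x :: l).count v := by
      simp [List.count_append, List.count_cons]
    have h3 := List.nodup_iff_count_le_one.1 hl v
    rw [h1, h2] at h
    exact h.trans (by omega)

theorem reachable_of_pathEdges_subset {B : Set (Sym2 V)} {l : List V}
    (h : ∀ e ∈ pathEdges l, e ∈ B) :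
    ∀ x ∈ l, ∀ y ∈ l, (SimpleGraph.fromEdgeSet B).Reachable x y := by
  suffices H : ∀ x m, (∀ e ∈ pathEdges (x :: m), e ∈ B) →
      ∀ y ∈ x :: m, (SimpleGraph.fromEdgeSet B).Reachable x y by
    cases l with
    | nil => simp
    | cons z l => exact fun x hx y hy => (H z l h x hx).symm.trans (H z l h y hy)
  intro x m
  induction m generalizing x with
  | nil =>
    intro _ y hy
    rw [List.mem_singleton.1 hy]
  | cons z m ih =>
    intro h y hy
    rw [pathEdges_cons_cons, List.forall_mem_cons] at h
    rcases List.mem_cons.1 hy with rfl | hy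
    · rfl
    · refine SimpleGraph.Reachable.trans ?_ (ih z h.2 y hy)
      by_cases hxz : x = z
      · rw [hxz]
      · exact SimpleGraph.Adj.reachable ((SimpleGraph.fromEdgeSet_adj B).2 ⟨h.1, hxz⟩)

theorem sum_toFinset_le {α : Type*} [DecidableEq α] {w : α → ℝ} (hw : ∀ e, 0 ≤ w e)
    (l : List α) : ∑ e ∈ l.toFinset, w e ≤ (l.map w).sum := by
  induction l with
  | nil => simp
  | cons x l ih =>
    rw [List.toFinset_cons, List.map_cons, List.sum_cons]
    by_cases hx : x ∈ l.toFinset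
    · rw [Finset.insert_eq_of_mem hx]
      linarith [hw x]
    · rw [Finset.sum_insert hx]
      linarith

/-! ### Minimum matchings compared with alternating edges; minimum spanning trees compared with
connecting sets -/

/-- The first and second, the third and fourth vertex of the list, and so on. -/
def consecutivePairs : List V → List (Sym2 V)
  | [] => []
  | [_] => []
  | x :: y :: l => s(x, y) :: consecutivePairs l

theorem length_consecutivePairs (l : List V) : (consecutivePairs l).length = l.length / 2 := by
  induction l using consecutivePairs.induct with
  | case1 => simp [consecutivePairs]
  | case2 => simp [consecutivePairs]
  | case3 x y l ih => simp only [consecutivePairs, List.length_cons, ih]; omega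

theorem mem_of_mem_consecutivePairs {l : List V} {e : Sym2 V} (he : e ∈ consecutivePairs l) {v : V}
    (hv : v ∈ e) : v ∈ l := by
  induction l using consecutivePairs.induct with
  | case1 => simp [consecutivePairs] at he
  | case2 => simp [consecutivePairs] at he
  | case3 x y l ih =>
    rcases List.mem_cons.1 he with rfl | he
    · rcases Sym2.mem_iff.1 hv with rfl | rfl <;> simp
    · simp [ih he]

theorem not_isDiag_of_mem_consecutivePairs {l : List V} (hl : l.Nodup) {e : Sym2 V}
    (he : e ∈ consecutivePairs l) : ¬ e.IsDiag := by
  induction l using consecutivePairs.induct with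
  | case1 => simp [consecutivePairs] at he
  | case2 => simp [consecutivePairs] at he
  | case3 x y l ih =>
    simp only [List.nodup_cons, List.mem_cons, not_or] at hl
    rcases List.mem_cons.1 he with rfl | he
    · simpa using hl.1.1
    · exact ih hl.2.2 he

theorem pairwise_disjoint_consecutivePairs {l : List V} (hl : l.Nodup) :
    (consecutivePairs l).Pairwise fun e f => ∀ v, v ∈ e → v ∉ f := by
  induction l using consecutivePairs.induct with
  | case1 => exact List.Pairwise.nil
  | case2 => exact List.Pairwise.nil
  | case3 x y l ih =>
    simp only [List.nodup_cons, List.mem_cons, not_or] at hl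
    refine List.Pairwise.cons (fun f hf v hv hvf => ?_) (ih hl.2.2)
    have := mem_of_mem_consecutivePairs hf hvf
    rcases Sym2.mem_iff.1 hv with rfl | rfl
    · exact hl.1.2 this
    · exact hl.2.1 this

/-- Competitors of a minimum matching must have exactly `m` pairs, so only the first `m` consecutive
pairs are kept. -/
theorem exists_isMatching_sum_le [DecidableEq V] {w : Sym2 V → ℝ} (hw : ∀ e, 0 ≤ w e)
    {S : Finset V} {l : List V} (hl : l.Nodup) (hS : ∀ v ∈ l, v ∈ S) {m : ℕ}
    (hm : m ≤ l.length / 2) :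
    ∃ M, IsMatching S M ∧ M.card = m ∧ ∑ e ∈ M, w e ≤ ((consecutivePairs l).map w).sum := by
  have hsub : ((consecutivePairs l).take m).Sublist (consecutivePairs l) := List.take_sublist _ _
  have hpw := (pairwise_disjoint_consecutivePairs hl).sublist hsub
  have hnd : ((consecutivePairs l).take m).Nodup :=
    hpw.imp fun {e f} h hef => by
      subst hef
      induction e using Sym2.ind with
      | _ x y => exact h x (Sym2.mem_mk_left x y) (Sym2.mem_mk_left x y)
  refine ⟨((consecutivePairs l).take m).toFinset, ⟨?_, ?_, ?_⟩, ?_, ?_⟩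
  · intro e he
    exact not_isDiag_of_mem_consecutivePairs hl (hsub.subset (List.mem_toFinset.1 he))
  · intro e he v hv
    exact hS v (mem_of_mem_consecutivePairs (hsub.subset (List.mem_toFinset.1 he)) hv)
  · intro e he f hf v hve hvf
    by_contra hef
    have hpw' : ((consecutivePairs l).take m).Pairwise fun e f => ∀ v, ¬ (v ∈ e ∧ v ∈ f) :=
      hpw.imp fun h v hv => h v hv.1 hv.2
    have : Std.Symm fun e f : Sym2 V => ∀ v, ¬ (v ∈ e ∧ v ∈ f) := ⟨fun _ _ h v hv => h v hv.symm⟩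
    exact hpw'.forall (List.mem_toFinset.1 he)
      (List.mem_toFinset.1 hf) hef v ⟨hve, hvf⟩
  · rw [List.toFinset_card_of_nodup hnd, List.length_take, length_consecutivePairs]
    exact min_eq_left hm
  · exact (sum_toFinset_le hw _).trans
      ((hsub.map w).sum_le_sum (by simpa using fun e _ => hw e))

/-- The edges of a walk alternate between pairs starting at even and at odd positions. -/
theorem sum_consecutivePairs_add (w : Sym2 V → ℝ) (l : List V) :
    ((consecutivePairs l).map w).sum + ((consecutivePairs l.tail).map w).sum =
      ((pathEdges l).map w).sum := by
  induction l with
  | nil => simp [consecutivePairs]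
  | cons x l ih =>
    cases l with
    | nil => simp [consecutivePairs]
    | cons y l =>
      simp only [List.tail_cons, consecutivePairs, pathEdges_cons_cons, List.map_cons,
        List.sum_cons] at ih ⊢
      linarith

theorem sum_consecutivePairs_le_concat {w : Sym2 V → ℝ} (hw : ∀ e, 0 ≤ w e) (l : List V) (x : V) :
    ((consecutivePairs l).map w).sum ≤ ((consecutivePairs (l ++ [x])).map w).sum := by
  induction l using consecutivePairs.induct with
  | case1 => simp [consecutivePairs]
  | case2 y => simpa [consecutivePairs] using hw _
  | case3 y z l ih => simpa [consecutivePairs] using ih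

/-- Both alternating classes of edges of the path contain enough pairs, and the cheaper one costs at
most half. The class that starts at the second vertex misses up to two vertices, which is exactly
what the `- 1` permits. -/
theorem IsMinMatching.sum_le_half_path [DecidableEq V] {w : Sym2 V → ℝ} (hw : ∀ e, 0 ≤ w e)
    {S : Finset V} {M : Finset (Sym2 V)} (hM : IsMinMatching w S (S.card / 2 - 1) M) {l : List V}
    (hl : l.Nodup) (hS : ∀ v, v ∈ l ↔ v ∈ S) :
    ∑ e ∈ M, w e ≤ 1 / 2 * ((pathEdges l).map w).sum := by
  have hcard : S.card = l.length := by
    rw [← List.toFinset_card_of_nodup hl]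
    congr 1
    ext v
    simp [hS]
  obtain ⟨M₁, h₁, c₁, s₁⟩ := exists_isMatching_sum_le hw hl (fun v hv => (hS v).1 hv)
    (m := S.card / 2 - 1) (by omega)
  obtain ⟨M₂, h₂, c₂, s₂⟩ := exists_isMatching_sum_le hw (hl.sublist (List.tail_sublist l))
    (fun v hv => (hS v).1 (List.mem_of_mem_tail hv)) (m := S.card / 2 - 1)
    (by rw [List.length_tail]; omega)
  have := hM.2 M₁ h₁ c₁
  have := hM.2 M₂ h₂ c₂
  have := sum_consecutivePairs_add w l
  linarith

theorem IsMinMatching.sum_le_half_cycle [DecidableEq V] {w : Sym2 V → ℝ} (hw : ∀ e, 0 ≤ w e)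
    {S : Finset V} {M : Finset (Sym2 V)} (hM : IsMinMatching w S (S.card / 2) M) {l : List V}
    (hl : l.Nodup) (hS : ∀ v, v ∈ l ↔ v ∈ S) :
    ∑ e ∈ M, w e ≤ 1 / 2 * ((cycleEdges l).map w).sum := by
  have hcard : S.card = l.length := by
    rw [← List.toFinset_card_of_nodup hl]
    congr 1
    ext v
    simp [hS]
  obtain ⟨M₁, h₁, c₁, s₁⟩ := exists_isMatching_sum_le hw hl (fun v hv => (hS v).1 hv)
    (m := S.card / 2) (by omega)
  have := hM.2 M₁ h₁ c₁
  cases l with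
  | nil =>
    simp only [consecutivePairs, cycleEdges, List.map_nil, List.sum_nil] at s₁ ⊢
    linarith
  | cons x l =>
    -- The second competitor pairs up the same cycle read from its second vertex. For odd length the
    -- two classes do not add up to the cycle, but `sum_consecutivePairs_le_concat` still gives the
    -- inequality, so no parity argument is needed.
    have hp : (l ++ [x]).Perm (x :: l) := List.perm_append_singleton x l
    obtain ⟨M₂, h₂, c₂, s₂⟩ := exists_isMatching_sum_le hw (hp.nodup_iff.2 hl)
      (fun v hv => (hS v).1 (hp.mem_iff.1 hv)) (m := S.card / 2) (by rw [hp.length_eq]; omega)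
    have := hM.2 M₂ h₂ c₂
    have h := sum_consecutivePairs_add w (x :: (l ++ [x]))
    have := sum_consecutivePairs_le_concat hw (x :: l) x
    rw [List.tail_cons] at h
    rw [List.cons_append] at this
    rw [cycleEdges]
    linarith

/-- Discard edges as long as the rest still connects. Thus, for non-negative costs, a minimum
spanning tree may be compared with any connecting set of admissible links. -/
theorem exists_isSpanningTree_subset [DecidableEq V] {S U : Finset V} {B : Set (Sym2 V)}
    {X : Finset (Sym2 V)} (hU : ∀ e ∈ X, ∀ v ∈ e, v ∈ U)
    (hX : Linked S (B ∪ (X : Set (Sym2 V)))) : ∃ F ⊆ X, IsSpanningTree S U B F := by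
  induction X using Finset.strongInduction with
  | H X ih =>
    by_cases h : ∃ e ∈ X, Linked S (B ∪ (X.erase e : Set (Sym2 V)))
    · obtain ⟨e, he, hl⟩ := h
      obtain ⟨F, hF, hT⟩ := ih (X.erase e) (Finset.erase_ssubset he)
        (fun f hf => hU f (Finset.mem_of_mem_erase hf)) hl
      exact ⟨F, hF.trans (Finset.erase_subset e X), hT⟩
    · push Not at h
      exact ⟨X, Finset.Subset.refl X, hU, hX, h⟩

theorem IsMST.sum_le [DecidableEq V] {w : Sym2 V → ℝ} (hw : ∀ e, 0 ≤ w e) {S U : Finset V}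
    {B : Set (Sym2 V)} {F X : Finset (Sym2 V)} (hF : IsMST w S U B F)
    (hU : ∀ e ∈ X, ∀ v ∈ e, v ∈ U) (hX : Linked S (B ∪ (X : Set (Sym2 V)))) :
    ∑ e ∈ F, w e ≤ ∑ e ∈ X, w e := by
  obtain ⟨F', hsub, hF'⟩ := exists_isSpanningTree_subset hU hX
  exact (hF.2 F' hF').trans (Finset.sum_le_sum_of_subset_of_nonneg hsub fun e _ _ => hw e)

theorem exists_mem_of_mem_oddVertices [Fintype V] [DecidableEq V] {H : Multiset (Sym2 V)} {v : V}
    (hv : v ∈ oddVertices H) : ∃ e ∈ H, v ∈ e := by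
  have h : Odd (deg H v) := (Finset.mem_filter.1 hv).2
  obtain ⟨e, he⟩ := Multiset.card_pos_iff_exists_mem.1 h.pos
  rw [Multiset.mem_filter] at he
  exact ⟨e, he.1, he.2.1⟩

end Lists

/-! ### Legs, special edges and the links between them -/

section Walks

variable {V J : Type*}

theorem IsShortcut.expandWalk_sublist {p : J → List V} {R R' : List (Leg J V)}
    (h : IsShortcut R R') : (expandWalk p R').Sublist (expandWalk p R) := by
  induction h with
  | nil => exact List.Sublist.refl _
  | @cons r r' R R' h _ ih =>
    obtain ⟨h1, h2, h3⟩ := h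
    simp only [expandWalk, List.flatMap_cons, h1, h2] at ih ⊢
    exact ((List.Sublist.refl _).append h3).append ih

/-- The legs enumerate the special edges, each exactly once. -/
theorem sum_map_idx [Fintype J] [DecidableEq J] {R : List (Leg J V)}
    (hR : ∀ j, (R.map Leg.idx).count j = 1) (f : J → ℝ) :
    (R.map fun r => f r.idx).sum = ∑ j, f j := by
  have hnd : (R.map Leg.idx).Nodup := List.nodup_iff_count_le_one.2 fun j => (hR j).le
  have huniv : (R.map Leg.idx).toFinset = Finset.univ := by
    ext j
    have h : j ∈ R.map Leg.idx := List.count_pos_iff.1 (by rw [hR j]; exact one_pos)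
    simpa using h
  rw [← huniv, List.sum_toFinset f hnd, List.map_map]
  rfl

/-- The links from the end of one special edge to the start of the next. -/
def linkEdges (a b : J → V) : List J → List (Sym2 V)
  | [] => []
  | [_] => []
  | i :: j :: l => s(b i, a j) :: linkEdges a b (j :: l)

theorem mem_of_mem_linkEdges {a b : J → V} {l : List J} {e : Sym2 V} (he : e ∈ linkEdges a b l)
    {v : V} (hv : v ∈ e) : ∃ i, v = a i ∨ v = b i := by
  induction l with
  | nil => simp [linkEdges] at he
  | cons i l ih =>
    cases l with
    | nil => simp [linkEdges] at he
    | cons j l =>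
      rcases List.mem_cons.1 he with rfl | he
      · rcases Sym2.mem_iff.1 hv with rfl | rfl
        · exact ⟨i, Or.inr rfl⟩
        · exact ⟨j, Or.inl rfl⟩
      · exact ih he

theorem reachable_of_mem {B : Set (Sym2 V)} {x y : V} (h : s(x, y) ∈ B) :
    (SimpleGraph.fromEdgeSet B).Reachable x y := by
  by_cases hxy : x = y
  · rw [hxy]
  · exact SimpleGraph.Adj.reachable ((SimpleGraph.fromEdgeSet_adj B).2 ⟨h, hxy⟩)

theorem reachable_of_linkEdges_subset {a b : J → V} {B : Set (Sym2 V)} (hB : ∀ i, s(a i, b i) ∈ B)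
    (i : J) (l : List J) (h : ∀ e ∈ linkEdges a b (i :: l), e ∈ B) :
    ∀ j ∈ i :: l, (SimpleGraph.fromEdgeSet B).Reachable (a i) (a j) := by
  induction l generalizing i with
  | nil =>
    intro j hj
    rw [List.mem_singleton.1 hj]
  | cons m l ih =>
    intro j hj
    rw [linkEdges, List.forall_mem_cons] at h
    rcases List.mem_cons.1 hj with rfl | hj
    · rfl
    · exact ((reachable_of_mem (hB i)).trans (reachable_of_mem h.1)).trans (ih m h.2 j hj)

theorem IsPostmanOutput.sum_map_idx [Fintype J] [Fintype V] [DecidableEq V]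
    [DecidableEq J] {w : Sym2 V → ℝ} {a b : J → V} {R : List (Leg J V)}
    (h : IsPostmanOutput w a b R) (f : J → ℝ) : (R.map fun r => f r.idx).sum = ∑ j, f j := by
  obtain ⟨R₁, R₂, h₁, h₂, hR, -⟩ := h
  rcases hR with rfl | rfl
  · obtain ⟨_, _, _, _, h⟩ := h₁
    exact ClusterRouting.sum_map_idx h.1 f
  · obtain ⟨_, _, _, _, h⟩ := h₂
    exact ClusterRouting.sum_map_idx h.1 f

theorem mem_specialEnds [Fintype J] [DecidableEq V] {a b : J → V} {v : V} :
    v ∈ specialEnds a b ↔ ∃ j, v = a j ∨ v = b j := by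
  simp only [specialEnds, Finset.mem_union, Finset.mem_image, Finset.mem_univ, true_and]
  constructor
  · rintro (⟨j, rfl⟩ | ⟨j, rfl⟩)
    exacts [⟨j, Or.inl rfl⟩, ⟨j, Or.inr rfl⟩]
  · rintro ⟨j, rfl | rfl⟩
    exacts [Or.inl ⟨j, rfl⟩, Or.inr ⟨j, rfl⟩]

theorem mem_specialEdges [Fintype J] {a b : J → V} {e : Sym2 V} :
    e ∈ specialEdges a b ↔ ∃ j, s(a j, b j) = e := by
  simp [specialEdges]

end Walks

/-! ### Metric costs: shortcutting, expanding special edges, linking -/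

namespace Problem

section Costs

variable {V : Type*} {k : ℕ} (I : Problem V k)

theorem c_nonneg (x y : V) : 0 ≤ I.c x y := by
  linarith [I.c_self x, I.c_triangle x y x, I.c_symm x y]

@[simp] theorem edgeCost_mk (x y : V) : I.edgeCost s(x, y) = I.c x y := rfl

theorem edgeCost_nonneg (e : Sym2 V) : 0 ≤ I.edgeCost e := by
  induction e using Sym2.ind with
  | _ x y => exact I.c_nonneg x y

theorem edgeCost_of_isDiag {e : Sym2 V} (he : e.IsDiag) : I.edgeCost e = 0 := by
  induction e using Sym2.ind with
  | _ x y =>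
    rw [Sym2.mk_isDiag_iff] at he
    rw [he, edgeCost_mk, I.c_self]

@[simp] theorem pathCost_nil : I.pathCost [] = 0 := rfl

@[simp] theorem pathCost_singleton (x : V) : I.pathCost [x] = 0 := rfl

@[simp] theorem pathCost_cons_cons (x y : V) (l : List V) :
    I.pathCost (x :: y :: l) = I.c x y + I.pathCost (y :: l) := by
  simp [pathCost]

theorem pathCost_append_cons (l : List V) (x : V) (m : List V) :
    I.pathCost (l ++ x :: m) = I.pathCost (l ++ [x]) + I.pathCost (x :: m) := by
  rw [pathCost, pathEdges_append_cons, List.map_append, List.sum_append]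
  rfl

theorem pathCost_nonneg (l : List V) : 0 ≤ I.pathCost l := by
  refine List.sum_nonneg ?_
  simpa using fun e _ => I.edgeCost_nonneg e

theorem pathCost_cons_le (x y : V) (l : List V) :
    I.pathCost (x :: l) ≤ I.c x y + I.pathCost (y :: l) := by
  cases l with
  | nil => simpa using I.c_nonneg x y
  | cons z l =>
    simp only [pathCost_cons_cons]
    linarith [I.c_triangle x y z]

theorem pathCost_cons_le_of_sublist {l l' : List V} (h : l'.Sublist l) (x : V) :
    I.pathCost (x :: l') ≤ I.pathCost (x :: l) := by
  induction h generalizing x with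
  | slnil => rfl
  | @cons l₁ l₂ a _ ih =>
    rw [pathCost_cons_cons]
    linarith [I.pathCost_cons_le x a l₁, ih a]
  | cons_cons a _ ih =>
    rw [pathCost_cons_cons, pathCost_cons_cons]
    linarith [ih a]

theorem pathCost_le_of_sublist {l l' : List V} (h : l'.Sublist l) :
    I.pathCost l' ≤ I.pathCost l := by
  induction h with
  | slnil => rfl
  | @cons l₁ l₂ a h ih =>
    refine ih.trans ?_
    cases l₂ with
    | nil => simp
    | cons y l => simpa using I.c_nonneg a y
  | cons_cons a h _ => exact I.pathCost_cons_le_of_sublist h a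

theorem pathCost_reverse (l : List V) : I.pathCost l.reverse = I.pathCost l := by
  induction l with
  | nil => rfl
  | cons x l ih =>
    cases l with
    | nil => rfl
    | cons y l =>
      rw [List.reverse_cons, List.reverse_cons, List.append_assoc, List.singleton_append,
        pathCost_append_cons, ← List.reverse_cons, ih]
      simp [I.c_symm x y, add_comm]

theorem tourCost_cons (x : V) (l : List V) :
    I.tourCost (x :: l) = I.pathCost (x :: (l ++ [x])) := rfl

theorem pathCost_le_tourCost (l : List V) : I.pathCost l ≤ I.tourCost l := by
  cases l with
  | nil => rfl
  | cons x l =>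
    rw [tourCost_cons]
    exact I.pathCost_cons_le_of_sublist (List.sublist_append_left _ _) x

theorem tourCost_le_of_sublist {l l' : List V} (h : l'.Sublist l) :
    I.tourCost l' ≤ I.tourCost l := by
  induction h with
  | slnil => rfl
  | @cons l₁ l₂ a h ih =>
    refine ih.trans ?_
    cases l₂ with
    | nil => exact (I.pathCost_nonneg _)
    | cons y l =>
      rw [tourCost_cons, tourCost_cons, List.cons_append, pathCost_cons_cons]
      -- Dropping the base point `a` replaces the two steps from the last vertex `z` over `a` to `y`
      -- by one step from `z` to `y`.
      obtain ⟨m, z, hm⟩ : ∃ m z, y :: l = m ++ [z] :=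
        ⟨_, _, (List.dropLast_append_getLast (List.cons_ne_nil y l)).symm⟩
      rw [← List.cons_append, ← List.cons_append, hm, List.append_assoc, List.singleton_append,
        List.append_assoc, List.singleton_append, I.pathCost_append_cons m z [y],
        I.pathCost_append_cons m z [a]]
      simp only [pathCost_cons_cons, pathCost_singleton]
      linarith [I.c_triangle z a y]
  | cons_cons a h _ =>
    rw [tourCost_cons, tourCost_cons]
    exact I.pathCost_cons_le_of_sublist (h.append (List.Sublist.refl _)) a

/-- Repeating the base point is free since `c x x = 0`; the closed walk thereby takes the form to
which `pathCost_expandWalk` applies. -/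
theorem tourCost_eq_of_head {l : List V} {x : V} (h : l.head? = some x) :
    I.tourCost l = I.pathCost (x :: (l ++ [x])) := by
  cases l with
  | nil => simp at h
  | cons y l =>
    simp only [List.head?_cons, Option.some.injEq] at h
    subst h
    rw [tourCost_cons, List.cons_append, pathCost_cons_cons, I.c_self, zero_add]

theorem pathCost_cons_append {p : List V} {x y : V} (hx : p.head? = some x)
    (hy : p.getLast? = some y) (z : V) (m : List V) :
    I.pathCost (z :: (p ++ m)) = I.c z x + I.pathCost p + I.pathCost (y :: m) := by
  have h : I.pathCost (z :: p) = I.c z x + I.pathCost p := by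
    cases p with
    | nil => simp at hx
    | cons w p =>
      simp only [List.head?_cons, Option.some.injEq] at hx
      rw [hx, pathCost_cons_cons]
  obtain ⟨n, rfl⟩ := List.getLast?_eq_some_iff.1 hy
  rw [← h, List.append_assoc, List.singleton_append, ← List.cons_append, pathCost_append_cons,
    List.cons_append]

/-- Here `y` and `r` do not depend on `m`, so two walks with this common beginning and different
continuations can be compared by their continuations alone. -/
theorem pathCost_cons_append_eq (x : V) (l : List V) :
    ∃ y r, ∀ m, I.pathCost (x :: (l ++ m)) = r + I.pathCost (y :: m) := by
  obtain ⟨n, y, hn⟩ : ∃ n y, x :: l = n ++ [y] :=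
    ⟨_, _, (List.dropLast_append_getLast (List.cons_ne_nil x l)).symm⟩
  refine ⟨y, I.pathCost (n ++ [y]), fun m => ?_⟩
  rw [← List.cons_append, hn, List.append_assoc, List.singleton_append, pathCost_append_cons]

variable {J : Type*}

/-- A path and its special edge have the same ends, so the steps into and out of them agree and only
the inner cost changes. The preceding vertex `y` and the remainder `m` are arbitrary for the sake of
the induction. -/
theorem pathCost_expandWalk {p : J → List V} {a b : J → V} (ha : ∀ j, (p j).head? = some (a j))
    (hb : ∀ j, (p j).getLast? = some (b j)) (R : List (Leg J V)) (y : V) (m : List V) :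
    I.pathCost (y :: (expandWalk p R ++ m)) = I.pathCost (y :: (postmanWalk a b R ++ m)) +
      (R.map fun r => I.pathCost (p r.idx) - I.c (a r.idx) (b r.idx)).sum := by
  induction R generalizing y with
  | nil => simp [expandWalk, postmanWalk]
  | cons r R ih =>
    rw [expandWalk, postmanWalk] at ih ⊢
    simp only [List.flatMap_cons, List.append_assoc, List.map_cons, List.sum_cons]
    cases r.flip with
    | false =>
      simp only [Bool.false_eq_true, if_false]
      rw [I.pathCost_cons_append (ha r.idx) (hb r.idx),
        I.pathCost_cons_append (p := [a r.idx, b r.idx]) (y := b r.idx) rfl rfl]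
      obtain ⟨z, K, h⟩ := I.pathCost_cons_append_eq (b r.idx) r.mid
      rw [h, h, ih]
      simp only [pathCost_cons_cons, pathCost_singleton]
      ring
    | true =>
      simp only [if_true]
      rw [I.pathCost_cons_append (p := (p r.idx).reverse) (x := b r.idx) (y := a r.idx)
        (by rw [List.head?_reverse, hb]) (by rw [List.getLast?_reverse, ha]),
        I.pathCost_cons_append (p := [b r.idx, a r.idx]) (y := a r.idx) rfl rfl]
      obtain ⟨z, K, h⟩ := I.pathCost_cons_append_eq (a r.idx) r.mid
      rw [h, h, ih, pathCost_reverse]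
      simp only [pathCost_cons_cons, pathCost_singleton, I.c_symm (b r.idx)]
      ring

theorem tourCost_expandWalk {p : J → List V} {a b : J → V} (ha : ∀ j, (p j).head? = some (a j))
    (hb : ∀ j, (p j).getLast? = some (b j)) (R : List (Leg J V)) :
    I.tourCost (expandWalk p R) = I.tourCost (postmanWalk a b R) +
      (R.map fun r => I.pathCost (p r.idx) - I.c (a r.idx) (b r.idx)).sum := by
  cases R with
  | nil => simp [expandWalk, postmanWalk]
  | cons r R =>
    obtain ⟨x, hx, hx'⟩ : ∃ x, (expandWalk p (r :: R)).head? = some x ∧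
        (postmanWalk a b (r :: R)).head? = some x := by
      simp only [expandWalk, postmanWalk, List.flatMap_cons, List.head?_append]
      cases r.flip with
      | false => exact ⟨a r.idx, by simp [ha]⟩
      | true => exact ⟨b r.idx, by simp [hb]⟩
    rw [I.tourCost_eq_of_head hx, I.tourCost_eq_of_head hx', I.pathCost_expandWalk ha hb]

theorem sum_filter_not_isDiag [DecidableEq V] (H : Multiset (Sym2 V)) :
    ((H.filter fun e => ¬ e.IsDiag).map I.edgeCost).sum = (H.map I.edgeCost).sum := by
  induction H using Multiset.induction with
  | empty => rfl
  | cons e H ih =>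
    by_cases he : e.IsDiag
    · rw [Multiset.filter_cons_of_neg (p := fun e : Sym2 V => ¬ e.IsDiag) _ (by simpa using he), ih, Multiset.map_cons,
        Multiset.sum_cons, I.edgeCost_of_isDiag he, zero_add]
    · rw [Multiset.filter_cons_of_pos (p := fun e : Sym2 V => ¬ e.IsDiag) _ he, Multiset.map_cons, Multiset.map_cons,
        Multiset.sum_cons, Multiset.sum_cons, ih]

theorem tourCost_postmanWalk [Fintype J] [DecidableEq V] [DecidableEq J] {a b : J → V}
    {H : Multiset (Sym2 V)} {R : List (Leg J V)} (h : IsEulerTour a b H R) :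
    I.tourCost (postmanWalk a b R) = (H.map I.edgeCost).sum := by
  rw [← I.sum_filter_not_isDiag H, ← h.2, I.sum_filter_not_isDiag, Multiset.map_coe,
    Multiset.sum_coe]
  rfl

/-- Linking consecutive special edges costs at most as much as linking consecutive segments, plus
two detours inside every segment. -/
theorem sum_linkEdges_le {a b : J → V} {q : J → List V} {d : J → ℝ}
    (hd : ∀ i x y, x = a i ∨ x = b i → y ∈ q i → I.c x y ≤ d i) (hq : ∀ i, q i ≠ []) (i : J)
    (l : List J) :
    ((linkEdges a b (i :: l)).map I.edgeCost).sum + ((i :: l).map fun j => I.pathCost (q j)).sum ≤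
      I.pathCost ((i :: l).map q).flatten + d i + 2 * (l.map d).sum := by
  have hx : ∀ i, ∃ x, (q i).head? = some x ∧ x ∈ q i := fun i =>
    ⟨(q i).head (hq i), List.head?_eq_some_head (hq i), List.head_mem (hq i)⟩
  have hy : ∀ i, ∃ x, (q i).getLast? = some x ∧ x ∈ q i := fun i =>
    ⟨(q i).getLast (hq i), List.getLast?_eq_some_getLast (hq i), List.getLast_mem (hq i)⟩
  induction l generalizing i with
  | nil =>
    obtain ⟨x, -, hx⟩ := hx i
    have := (I.c_nonneg _ _).trans (hd i (a i) x (Or.inl rfl) hx)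
    simpa [linkEdges] using this
  | cons j l ih =>
    obtain ⟨x, hx, hxm⟩ := hx i
    obtain ⟨y, hy, hym⟩ := hy i
    obtain ⟨z, hz, hzm⟩ := ‹∀ i, ∃ x, (q i).head? = some x ∧ x ∈ q i› j
    have h1 := I.pathCost_cons_append hx hy x ((j :: l).map q).flatten
    have h2 : I.pathCost (x :: (q i ++ ((j :: l).map q).flatten)) =
        I.pathCost ((i :: j :: l).map q).flatten := by
      cases hqi : q i with
      | nil => exact absurd hqi (hq i)
      | cons w m =>
        rw [hqi] at hx
        simp only [List.head?_cons, Option.some.injEq] at hx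
        subst hx
        simp [hqi, I.c_self]
    have h3 : I.pathCost (y :: ((j :: l).map q).flatten) =
        I.c y z + I.pathCost ((j :: l).map q).flatten := by
      cases hqj : q j with
      | nil => exact absurd hqj (hq j)
      | cons w m =>
        rw [hqj] at hz
        simp only [List.head?_cons, Option.some.injEq] at hz
        subst hz
        simp [hqj]
    rw [h2, h3, I.c_self] at h1
    have h4 := ih j
    -- The link from `b i` to `a j` is rerouted through the last vertex `y` of `q i` and the first
    -- vertex `z` of `q j`. Leaving is charged to `d i`, entering to `d j`; the first segment of the
    -- list is only left, hence its single `d i`.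
    have h5 := hd i (b i) y (Or.inr rfl) hym
    have h6 := hd j (a j) z (Or.inl rfl) hzm
    have h7 := I.c_triangle (b i) y (a j)
    have h8 := I.c_triangle y z (a j)
    rw [I.c_symm z] at h8
    rw [h1]
    simp only [linkEdges, List.map_cons, List.sum_cons, edgeCost_mk] at h4 ⊢
    linarith

end Costs

/-! ### Edges inside clusters lie on segments -/

section Segments

variable {V : Type*}

theorem mem_pathEdges_append {l m : List V} {e : Sym2 V} (he : e ∈ pathEdges (l ++ m)) :
    e ∈ pathEdges l ∨ e ∈ pathEdges m ∨ ∃ x ∈ l, ∃ y ∈ m, e = s(x, y) := by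
  induction l with
  | nil => exact Or.inr (Or.inl he)
  | cons x l ih =>
    cases l with
    | nil =>
      cases m with
      | nil => simp at he
      | cons y m =>
        rcases List.mem_cons.1 he with rfl | he
        · exact Or.inr (Or.inr ⟨x, by simp, y, by simp, rfl⟩)
        · exact Or.inr (Or.inl he)
    | cons z l =>
      rcases List.mem_cons.1 he with rfl | he
      · exact Or.inl (by simp)
      · rcases ih he with h | h | ⟨u, hu, y, hy, h⟩
        · exact Or.inl (by simp [h])
        · exact Or.inr (Or.inl h)
        · exact Or.inr (Or.inr ⟨u, List.mem_cons_of_mem _ hu, y, hy, h⟩)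

theorem exists_mem_pathEdges_of_flatten {α : Type*} {g : V → α} {L : List (List V)}
    (hL : L.Pairwise fun l l' => ∀ x ∈ l, ∀ y ∈ l', g x ≠ g y) {e : Sym2 V}
    (he : e ∈ pathEdges L.flatten) (hg : ∀ x ∈ e, ∀ y ∈ e, g x = g y) :
    ∃ l ∈ L, e ∈ pathEdges l := by
  induction L with
  | nil => simp at he
  | cons l L ih =>
    rw [List.pairwise_cons] at hL
    rw [List.flatten_cons] at he
    rcases mem_pathEdges_append he with h | h | ⟨x, hx, y, hy, rfl⟩
    · exact ⟨l, by simp, h⟩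
    · obtain ⟨l', hl', h⟩ := ih hL.2 h
      exact ⟨l', List.mem_cons_of_mem _ hl', h⟩
    · obtain ⟨l', hl', hy⟩ := List.mem_flatten.1 hy
      exact absurd (hg x (Sym2.mem_mk_left x y) y (Sym2.mem_mk_right x y)) (hL.1 l' hl' x hx y hy)

/-- With at least two segments the closing edge, like every other edge between segments, joins
different values of `g`. For a single segment this fails, which forces a separate case in the
theorem. -/
theorem exists_mem_pathEdges_of_cycleEdges {α : Type*} {g : V → α} {l m : List V}
    {L : List (List V)}
    (hL : (l :: m :: L).Pairwise fun l l' => ∀ x ∈ l, ∀ y ∈ l', g x ≠ g y) (hl : l ≠ [])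
    (hm : m ≠ []) {e : Sym2 V} (he : e ∈ cycleEdges (l :: m :: L).flatten)
    (hg : ∀ x ∈ e, ∀ y ∈ e, g x = g y) : ∃ l' ∈ l :: m :: L, e ∈ pathEdges l' := by
  have hne : (m :: L).flatten ≠ [] := by simp [hm]
  have hx : ((l :: m :: L).flatten).head? = some (l.head hl) := by
    rw [List.flatten_cons, List.head?_append_of_ne_nil _ hl, List.head?_eq_some_head hl]
  have hy : ((l :: m :: L).flatten).getLast? = some ((m :: L).flatten.getLast hne) := by
    rw [List.flatten_cons, List.getLast?_append_of_ne_nil _ hne,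
      List.getLast?_eq_some_getLast hne]
  rw [cycleEdges_eq_append hx hy, List.mem_append, List.mem_singleton] at he
  rcases he with he | rfl
  · exact exists_mem_pathEdges_of_flatten hL he hg
  · obtain ⟨l', hl', hy'⟩ := List.mem_flatten.1 (List.getLast_mem hne)
    exact absurd (hg _ (Sym2.mem_mk_right _ _) _ (Sym2.mem_mk_left _ _))
      ((List.pairwise_cons.1 hL).1 l' hl' _ (List.head_mem hl) _ hy')

end Segments

/-! ### The path algorithm, the shortcut optimal tour and Short-Arcs 2 -/

section Algorithm

variable {V : Type*} [Fintype V] [DecidableEq V] {k : ℕ} {I : Problem V k}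

theorem mem_clusterV {i : Fin k} {v : V} :
    v ∈ I.clusterV i ↔ I.cluster v = i ∧ I.IsTerminal v := by
  simp [clusterV]

theorem mem_clusterV_of_mem_clusterE {i : Fin k} {e : Sym2 V} (he : e ∈ I.clusterE i) {v : V}
    (hv : v ∈ e) : v ∈ I.clusterV i := by
  rw [clusterE, Finset.mem_filter] at he
  exact mem_clusterV.2 ⟨he.2 v hv, Or.inr ⟨e, he.1, hv⟩⟩

theorem IsPathOutput.mem_iff {i : Fin k} {p : List V} (h : I.IsPathOutput i p) {v : V} :
    v ∈ p ↔ v ∈ I.clusterV i := by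
  obtain ⟨F, M, w, -, -, hw, -, hp, -, hv, -⟩ := h
  exact ⟨fun h => (hw v).1 (hp.subset h), hv v⟩

/-- The terminals of a cluster, in the order of the tour, together with edges of a path or cycle
through them that contain the required edges, bound the cost of the path computed. -/
theorem IsPathOutput.pathCost_le {i : Fin k} {p : List V} (h : I.IsPathOutput i p) {q : List V}
    (hq : q.Nodup) (hmem : ∀ v, v ∈ q ↔ v ∈ I.clusterV i) {Y : List (Sym2 V)}
    (hY : pathEdges q ⊆ Y) (hY' : Y ⊆ cycleEdges q) (hE : ∀ e ∈ I.clusterE i, e ∈ Y) :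
    I.pathCost p ≤ (Y.map I.edgeCost).sum + 1 / 2 * I.pathCost q := by
  obtain ⟨F, M, w, hF, hM, -, hw, hp, -⟩ := h
  -- On a cycle at most two edges meet at `v`. If one of them is not required, at most one required
  -- edge is left there, so `v` is an admissible end of a link.
  have hU : ∀ e ∈ Y.toFinset \ I.clusterE i, ∀ v ∈ e, v ∈ I.clusterU i := by
    intro e he v hv
    rw [Finset.mem_sdiff, List.mem_toFinset] at he
    refine Finset.mem_filter.2 ⟨(hmem v).1 (mem_of_mem_cycleEdges (hY' he.1) hv), ?_⟩
    have hdeg : deg (I.clusterE i).val v =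
        ((I.clusterE i).filter fun e => v ∈ e ∧ ¬ e.IsDiag).card := rfl
    rw [hdeg]
    have hins : insert e ((I.clusterE i).filter fun e => v ∈ e ∧ ¬ e.IsDiag) ⊆
        ((cycleEdges q).filter fun e => v ∈ e).toFinset := by
      intro f hf
      rw [List.mem_toFinset, List.mem_filter]
      rcases Finset.mem_insert.1 hf with rfl | hf
      · exact ⟨hY' he.1, by simpa using hv⟩
      · rw [Finset.mem_filter] at hf
        exact ⟨hY' (hE f hf.1), by simpa using hf.2.1⟩
    have h1 := Finset.card_le_card hins
    rw [Finset.card_insert_of_notMem fun h => he.2 (Finset.mem_filter.1 h).1] at h1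
    have h2 := h1.trans (List.toFinset_card_le _)
    rw [← List.countP_eq_length_filter] at h2
    have h3 := countP_cycleEdges_le_two v hq
    omega
  have hlink : Linked (I.clusterV i)
      ({e | e ∈ I.clusterE i} ∪ ((Y.toFinset \ I.clusterE i : Finset _) : Set (Sym2 V))) := by
    intro x hx y hy
    refine reachable_of_pathEdges_subset (l := q) (fun e he => ?_) x ((hmem x).2 hx) y
      ((hmem y).2 hy)
    by_cases h : e ∈ I.clusterE i
    · exact Or.inl h
    · exact Or.inr (by simpa using ⟨hY he, h⟩)
  -- The part of `Y` that is not required competes with the tree, so required edges and tree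
  -- together cost at most `Y`.
  have hF' := hF.sum_le I.edgeCost_nonneg hU hlink
  have hsub : I.clusterE i ⊆ Y.toFinset := fun e he => List.mem_toFinset.2 (hE e he)
  have hsplit := Finset.sum_sdiff (f := I.edgeCost) hsub
  have hY2 := sum_toFinset_le I.edgeCost_nonneg Y
  have hodd : ∀ v, v ∈ q.filter (fun v => v ∈ oddVertices ((I.clusterE i).val + F.val)) ↔
      v ∈ oddVertices ((I.clusterE i).val + F.val) := by
    intro v
    simp only [List.mem_filter, decide_eq_true_eq, and_iff_right_iff_imp]
    intro hv
    obtain ⟨e, he, hve⟩ := exists_mem_of_mem_oddVertices hv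
    rw [hmem]
    rcases Multiset.mem_add.1 he with he | he
    · exact mem_clusterV_of_mem_clusterE he hve
    · exact (Finset.mem_filter.1 (hF.1.links e he v hve)).1
  -- The odd vertices, in the order of `q`, form a shortcut of `q`.
  have hM' := hM.sum_le_half_path I.edgeCost_nonneg (hq.filter _) hodd
  have hfilt := I.pathCost_le_of_sublist (List.filter_sublist (l := q)
    (p := fun v => v ∈ oddVertices ((I.clusterE i).val + F.val)))
  have hcost : I.pathCost w = ∑ e ∈ I.clusterE i, I.edgeCost e + ∑ e ∈ F, I.edgeCost e +
      ∑ e ∈ M, I.edgeCost e := by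
    have h := congrArg (fun H => (Multiset.map I.edgeCost H).sum) hw
    simp only [Multiset.map_add, Multiset.sum_add, Multiset.map_coe, Multiset.sum_coe] at h
    exact h
  have hpw := I.pathCost_le_of_sublist hp
  change _ ≤ 1 / 2 * I.pathCost _ at hM'
  linarith

/-- Delete all non-terminals from the tour and discard the segments that become empty. `q i`
collects the terminals of cluster `i` in tour order, and `Js` is the order in which the active
clusters are met. -/
theorem IsTour.exists_segments {O : List (List V)} (hO : I.IsTour O) :
    ∃ (Js : List I.Active) (q : I.Active → List V), Js.Nodup ∧ (∀ i, i ∈ Js) ∧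
      (∀ i v, v ∈ q i ↔ v ∈ I.clusterV i.1) ∧ (Js.map q).flatten.Nodup ∧
      (∀ e ∈ I.reqE, e ∈ cycleEdges (Js.map q).flatten) ∧
      I.tourCost (Js.map q).flatten ≤ I.tourCost O.flatten ∧
      (Js.map fun j => I.pathCost (q j)).sum ≤ I.insideCost O := by
  set N := (O.map fun l => l.filter fun v => I.IsTerminal v).filter fun l => !l.isEmpty with hN
  set q : I.Active → List V := fun i => O.flatten.filter fun v => v ∈ I.clusterV i.1 with hq
  have hflat : N.flatten = O.flatten.filter fun v => I.IsTerminal v := by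
    rw [hN, List.flatten_filter_not_isEmpty, List.filter_flatten]
  have hqm : ∀ i v, v ∈ q i ↔ v ∈ I.clusterV i.1 := by
    intro i v
    simp only [hq, List.mem_filter, decide_eq_true_eq, and_iff_right_iff_imp]
    intro hv
    exact List.count_pos_iff.1 (by rw [hO.visits v (mem_clusterV.1 hv).2]; exact one_pos)
  -- The segments before and after `m` avoid its cluster, so the terminals of that cluster are
  -- exactly those of `m`.
  have hseg : ∀ l ∈ N, ∃ i, q i = l := by
    intro l hl
    rw [hN, List.mem_filter, List.mem_map] at hl
    obtain ⟨⟨m, hm, rfl⟩, hne⟩ := hl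
    obtain ⟨x, hx⟩ := List.exists_mem_of_ne_nil _ (by simpa using hne :
      m.filter (fun v => I.IsTerminal v) ≠ [])
    rw [List.mem_filter, decide_eq_true_eq] at hx
    refine ⟨⟨I.cluster x, x, mem_clusterV.2 ⟨rfl, hx.2⟩⟩, ?_⟩
    obtain ⟨A, B, rfl⟩ := List.append_of_mem hm
    have hc := hO.consecutive
    rw [List.pairwise_append, List.pairwise_cons] at hc
    have hA : A.flatten.filter (fun v => v ∈ I.clusterV (I.cluster x)) = [] := by
      rw [List.filter_eq_nil_iff]
      intro v hv
      obtain ⟨l, hl, hv⟩ := List.mem_flatten.1 hv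
      simp [mem_clusterV, hc.2.2 l hl m (by simp) v hv x hx.1]
    have hB : B.flatten.filter (fun v => v ∈ I.clusterV (I.cluster x)) = [] := by
      rw [List.filter_eq_nil_iff]
      intro v hv
      obtain ⟨l, hl, hv⟩ := List.mem_flatten.1 hv
      simp [mem_clusterV, (hc.2.1.1 l hl x hx.1 v hv).symm]
    simp only [hq, List.flatten_append, List.flatten_cons, List.filter_append, hA, hB,
      List.nil_append, List.append_nil]
    refine List.filter_congr fun v hv => ?_
    simp [mem_clusterV, hO.in_cluster m (by simp) v hv x hx.1]
  obtain ⟨Js, hJs⟩ : ∃ Js : List I.Active, Js.map q = N := by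
    have : N ∈ Set.range (List.map q) := by
      rw [Set.range_list_map]
      exact hseg
    exact this
  have hnd : N.flatten.Nodup := by
    rw [hflat, List.nodup_iff_count_le_one]
    intro v
    by_cases hv : I.IsTerminal v
    · exact (List.Sublist.count_le v List.filter_sublist).trans (hO.visits v hv).le
    · rw [List.count_eq_zero_of_not_mem (by simp [hv])]
      exact zero_le_one
  have hne : ∀ i, ∃ v, v ∈ q i := fun i => i.2.imp fun v hv => (hqm i v).2 hv
  refine ⟨Js, q, ?_, ?_, hqm, by rwa [hJs], ?_, ?_, ?_⟩
  · have h := (List.nodup_flatten.1 hnd).2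
    rw [← hJs, List.pairwise_map] at h
    refine h.imp fun {i j} hij heq => ?_
    subst heq
    obtain ⟨v, hv⟩ := hne i
    exact hij hv hv
  · intro i
    obtain ⟨v, hv⟩ := i.2
    have hvN : v ∈ (Js.map q).flatten := by
      rw [hJs, hflat, List.mem_filter]
      exact ⟨(List.mem_filter.1 ((hqm i v).2 hv)).1, by simpa using (mem_clusterV.1 hv).2⟩
    obtain ⟨l, hl, hvl⟩ := List.mem_flatten.1 hvN
    obtain ⟨j, hj, rfl⟩ := List.mem_map.1 hl
    have hij : i = j := Subtype.ext
      ((mem_clusterV.1 hv).1.symm.trans (mem_clusterV.1 ((hqm j v).1 hvl)).1)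
    rwa [hij]
  · intro e he
    rw [hJs, hflat]
    exact mem_cycleEdges_filter _ (hO.traverses e he) fun v hv => Or.inr ⟨e, he, hv⟩
  · rw [hJs, hflat]
    exact I.tourCost_le_of_sublist List.filter_sublist
  · have h : (Js.map fun j => I.pathCost (q j)) = N.map I.pathCost := by
      rw [← hJs, List.map_map]
      rfl
    rw [h, hN, insideCost]
    refine (List.Sublist.sum_le_sum (List.filter_sublist.map _) ?_).trans ?_
    · intro r hr
      obtain ⟨l, -, rfl⟩ := List.mem_map.1 hr
      exact I.pathCost_nonneg l
    · rw [List.map_map]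
      exact List.sum_le_sum fun l _ => I.pathCost_le_of_sublist List.filter_sublist

/-- The three summands bound the special edges, the tree (the links in the order `Js` connect the
special edges) and the matching (the odd vertices lie on `l`). -/
theorem tourCost_le_of_isShortArcsOutput {J : Type*} [Fintype J] [DecidableEq J] {a b : J → V}
    {R : List (Leg J V)} (h : IsShortArcsOutput I.edgeCost a b R) {Js : List J}
    (hJs : ∀ j, j ∈ Js) {l : List V} (hl : l.Nodup) (hal : ∀ j, a j ∈ l) (hbl : ∀ j, b j ∈ l) :
    I.tourCost (postmanWalk a b R) ≤ ∑ j, I.c (a j) (b j) +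
      ((linkEdges a b Js).map I.edgeCost).sum + 1 / 2 * I.tourCost l := by
  obtain ⟨F, M, hF, hM, hR⟩ := h
  have hends : ∀ v ∈ specialEnds a b, v ∈ l := by
    intro v hv
    obtain ⟨j, rfl | rfl⟩ := mem_specialEnds.1 hv
    exacts [hal j, hbl j]
  have hlink : Linked (specialEnds a b)
      ({e | e ∈ specialEdges a b} ∪ ((linkEdges a b Js).toFinset : Set (Sym2 V))) := by
    have hB : ∀ j, s(a j, b j) ∈ ({e | e ∈ specialEdges a b} ∪
        ((linkEdges a b Js).toFinset : Set (Sym2 V))) :=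
      fun j => Or.inl (mem_specialEdges.2 ⟨j, rfl⟩)
    cases Js with
    | nil =>
      intro x hx
      obtain ⟨j, -⟩ := mem_specialEnds.1 hx
      exact absurd (hJs j) (by simp)
    | cons i Js =>
      have h : ∀ x ∈ specialEnds a b, (SimpleGraph.fromEdgeSet ({e | e ∈ specialEdges a b} ∪
          ((linkEdges a b (i :: Js)).toFinset : Set (Sym2 V)))).Reachable (a i) x := by
        intro x hx
        obtain ⟨j, hj⟩ := mem_specialEnds.1 hx
        have h := reachable_of_linkEdges_subset hB i Js
          (fun e he => Or.inr (by simpa using he)) j (hJs j)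
        rcases hj with rfl | rfl
        · exact h
        · exact h.trans (reachable_of_mem (hB j))
      exact fun x hx y hy => (h x hx).symm.trans (h y hy)
  have hF' := (hF.sum_le I.edgeCost_nonneg (fun e he v hv =>
    mem_specialEnds.2 (mem_of_mem_linkEdges (List.mem_toFinset.1 he) hv)) hlink).trans
    (sum_toFinset_le I.edgeCost_nonneg _)
  have hodd : ∀ v, v ∈ l.filter (fun v => v ∈ oddVertices (specialEdges a b + F.val)) ↔
      v ∈ oddVertices (specialEdges a b + F.val) := by
    intro v
    simp only [List.mem_filter, decide_eq_true_eq, and_iff_right_iff_imp]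
    intro hv
    obtain ⟨e, he, hve⟩ := exists_mem_of_mem_oddVertices hv
    rcases Multiset.mem_add.1 he with he | he
    · obtain ⟨j, rfl⟩ := mem_specialEdges.1 he
      rcases Sym2.mem_iff.1 hve with rfl | rfl
      exacts [hal j, hbl j]
    · exact hends v (hF.1.links e he v hve)
  have hM' := hM.sum_le_half_cycle I.edgeCost_nonneg (hl.filter _) hodd
  have hfilt := I.tourCost_le_of_sublist (List.filter_sublist (l := l)
    (p := fun v => v ∈ oddVertices (specialEdges a b + F.val)))
  have hcost : I.tourCost (postmanWalk a b R) = ∑ j, I.c (a j) (b j) + ∑ e ∈ F, I.edgeCost e +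
      ∑ e ∈ M, I.edgeCost e := by
    rw [I.tourCost_postmanWalk hR, Multiset.map_add, Multiset.map_add, Multiset.sum_add,
      Multiset.sum_add, specialEdges, Multiset.map_map]
    rfl
  change _ ≤ 1 / 2 * I.tourCost _ at hM'
  linarith

/-- The cost of the special edges cancels: it appears in the Short-Arcs bound and is subtracted when
the paths are inserted. The order `Js` and the cycle `l` stay free, to be taken from the optimal
tour. -/
theorem IsPostmanTour.tourCost_le {T : List V} (hT : I.IsPostmanTour T) :
    ∃ (p : I.Active → List V) (a b : I.Active → V), (∀ i, I.IsPathOutput i.1 (p i)) ∧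
      (∀ i, a i ∈ I.clusterV i.1) ∧ (∀ i, b i ∈ I.clusterV i.1) ∧
      ∀ (Js : List I.Active) (l : List V), (∀ i, i ∈ Js) → l.Nodup →
        (∀ i, ∀ v ∈ I.clusterV i, v ∈ l) →
        I.tourCost T ≤ ∑ i, I.pathCost (p i) + ((linkEdges a b Js).map I.edgeCost).sum +
          1 / 2 * I.tourCost l := by
  obtain ⟨p, a, b, R, R', hp, ha, hb, hR, hs, rfl⟩ := hT
  have ha' : ∀ i, a i ∈ I.clusterV i.1 := fun i => (hp i).mem_iff.1 (List.mem_of_head? (ha i))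
  have hb' : ∀ i, b i ∈ I.clusterV i.1 := fun i => (hp i).mem_iff.1 (List.mem_of_getLast? (hb i))
  refine ⟨p, a, b, hp, ha', hb', fun Js l hJs hl hmem => ?_⟩
  have h3 := I.tourCost_le_of_sublist (hs.expandWalk_sublist (p := p))
  rw [I.tourCost_expandWalk ha hb R,
    hR.sum_map_idx fun i => I.pathCost (p i) - I.c (a i) (b i), Finset.sum_sub_distrib] at h3
  obtain ⟨R₁, R₂, h₁, h₂, -, hle, -⟩ := hR
  have h4 := tourCost_le_of_isShortArcsOutput h₁ hJs hl (fun j => hmem _ _ (ha' j))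
    (fun j => hmem _ _ (hb' j))
  change I.tourCost _ ≤ I.tourCost _ at hle
  linarith

end Algorithm

end Problem

end ClusterRouting

/-! ### The theorem, by the number of active clusters -/

theorem mainTheorem5 {V : Type*} [Fintype V] [DecidableEq V] {k : ℕ}
    (I : ClusterRouting.Problem V k)
    (O : List (List V)) (hO : I.IsOptimalTour O)
    (s t : I.Active → V) (hst : I.IsFarthestPair s t)
    (T₁ : List V) (hT₁ : I.IsPostmanTour T₁) :
    I.tourCost T₁ ≤
      3 / 2 * I.tourCost O.flatten + 1 / 2 * I.insideCost O + 2 * ∑ i, I.c (s i) (t i) := by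
  obtain ⟨Js, q, hnd, hall, hq, hfl, hreq, htour, hins⟩ := hO.1.exists_segments
  obtain ⟨p, a, b, hp, ha, hb, hT⟩ := hT₁.tourCost_le
  have hT := hT Js (Js.map q).flatten hall hfl fun i v hv =>
    List.mem_flatten.2 ⟨q ⟨i, v, hv⟩, List.mem_map_of_mem (hall _), (hq ⟨i, v, hv⟩ v).2 hv⟩
  have hsum : ∀ f : I.Active → ℝ, ∑ i, f i = (Js.map f).sum := fun f => by
    rw [← List.sum_toFinset f hnd]
    congr 1
    ext i
    simp [hall]
  have hqnd : ∀ i, (q i).Nodup := fun i =>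
    (List.nodup_flatten.1 hfl).1 _ (List.mem_map_of_mem (hall i))
  have hqne : ∀ i, q i ≠ [] := fun i => by
    obtain ⟨v, hv⟩ := i.2
    exact List.ne_nil_of_mem ((hq i v).2 hv)
  have hD : 0 ≤ ∑ i, I.c (s i) (t i) := Finset.sum_nonneg fun i _ => I.c_nonneg _ _
  have hclE : ∀ i, I.clusterE i ⊆ I.reqE := fun i => Finset.filter_subset _ _
  have hcol : ∀ i, ∀ x ∈ q i, I.cluster x = i.1 := fun i x hx =>
    (ClusterRouting.Problem.mem_clusterV.1 ((hq i x).1 hx)).1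
  rw [hsum] at hT
  cases Js with
  | nil =>
    -- Nothing has to be visited: the computed tour costs at most 0, and OPT, L and D are
    -- non-negative.
    simp only [List.map_nil, List.sum_nil, List.flatten_nil, ClusterRouting.linkEdges]
      at hT htour hins
    change I.tourCost T₁ ≤ 0 + 0 + 1 / 2 * 0 at hT
    change 0 ≤ _ at htour
    linarith
  | cons i Js =>
    cases Js with
    | nil =>
      simp only [List.map_cons, List.map_nil, List.sum_cons, List.sum_nil, List.flatten_cons,
        List.flatten_nil, List.append_nil, add_zero, ClusterRouting.linkEdges] at hT htour hins hreq
      -- A required edge may be the closing edge of the only segment, so `Y` is the whole cycle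
      -- here.
      have h := (hp i).pathCost_le (hqnd i) (hq i)
        (ClusterRouting.pathEdges_sublist_cycleEdges _).subset (List.Subset.refl _)
        fun e he => hreq e (hclE _ he)
      change _ ≤ I.tourCost _ + _ at h
      linarith
    | cons j Js =>
      have hpw : ((i :: j :: Js).map q).Pairwise
          fun l l' => ∀ x ∈ l, ∀ y ∈ l', I.cluster x ≠ I.cluster y := by
        rw [List.pairwise_map]
        refine hnd.imp fun {m n} hmn x hx y hy hxy => hmn (Subtype.ext ?_)
        rw [← hcol m x hx, ← hcol n y hy, hxy]
      -- Required edges now lie on the open segments, so `Y` can be the edges of `q m` itself; this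
      -- gives the factor 1 + 1/2.
      have hP : ∀ m, I.pathCost (p m) ≤ 3 / 2 * I.pathCost (q m) := by
        intro m
        have h := (hp m).pathCost_le (hqnd m) (hq m) (List.Subset.refl _)
          (ClusterRouting.pathEdges_sublist_cycleEdges _).subset fun e he => by
            have hem : ∀ x ∈ e, I.cluster x = m.1 := (Finset.mem_filter.1 he).2
            obtain ⟨l, hl, hel⟩ := ClusterRouting.Problem.exists_mem_pathEdges_of_cycleEdges hpw
              (hqne i) (hqne j) (hreq e (hclE _ he)) fun x hx y hy => by rw [hem x hx, hem y hy]
            obtain ⟨n, -, rfl⟩ := (List.mem_map (f := q) (l := i :: j :: Js)).1 hl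
            have hmn : n = m := by
              induction e using Sym2.ind with
              | _ x y =>
                have hx := Sym2.mem_mk_left x y
                exact Subtype.ext ((hcol n x (ClusterRouting.mem_of_mem_pathEdges hel hx)).symm.trans
                  (hem x hx))
            rwa [← hmn]
        change _ ≤ I.pathCost _ + _ at h
        linarith
      have hPs : ((i :: j :: Js).map fun m => I.pathCost (p m)).sum ≤
          3 / 2 * ((i :: j :: Js).map fun m => I.pathCost (q m)).sum := by
        rw [← List.sum_map_mul_left]
        exact List.sum_le_sum fun m _ => hP m
      have hlink := I.sum_linkEdges_le (a := a) (b := b) (q := q) (d := fun m => I.c (s m) (t m))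
        (fun m x y hx hy => (hst m).2.2 x (by rcases hx with rfl | rfl; exacts [ha m, hb m]) y
          ((hq m y).1 hy)) hqne i (j :: Js)
      have hDl := hsum fun m => I.c (s m) (t m)
      rw [List.map_cons, List.sum_cons] at hDl
      have hi := I.c_nonneg (s i) (t i)
      -- The link bound subtracts one copy of the segments from their 3/2, leaving the 1/2 in front
      -- of L; opening the cycle only lowers its cost.
      have hpt := I.pathCost_le_tourCost ((i :: j :: Js).map q).flatten
      linarith
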